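/- **Setting.** Let $(\Omega,\mathcal F,P)$ be a complete probability space (for instance a Lebesgue space), $\vartheta:\Omega\to\Omega$ an invertible bimeasurable $P$-preserving map, $X$ a compact metric space with Borel $\sigma$-algebra $\mathcal B$, and $\mathcal E\subset\Omega\times X$ an $\mathcal F\otimes\mathcal B$-measurable set with compact fibres $\mathcal E_\omega=\{x:(\omega,x)\in\mathcal E\}$. Let $T$ be a homeomorphic bundle random dynamical system on $\mathcal E$ over $\vartheta$: a family of maps $T_\omega:\mathcal E_\omega\to\mathcal E_{\vartheta\omega}$ such that $(\omega,x)\mapsto T_\omega x$ is measurable on $\mathcal E$ and $T_\omega$ is a homeomorphism for $P$-a.e. $\omega$. Put $T^0_\omega=\mathrm{id}$, $T^n_\omega=T_{\vartheta^{n-1}\omega}\circ\cdots\circ T_\omega$ and $\Theta(\omega,x)=(\vartheta\omega,T_\omega x)$ on $\mathcal E$. Let $\mu$ be a probability measure on $\Omega\times X$ with marginal $P$ on $\Omega$, with $\mu(\mathcal E)=1$, and invariant under $\Theta$; write $d\mu(\omega,x)=d\mu_\omega(x)\,dP(\omega)$ for its disintegration. **Covers.** A *cover* $\mathcal U\in\mathcal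 C_{\mathcal E}$ is a finite family of measurable subsets of $\mathcal E$ with union $\mathcal E$. It is an *open cover* ($\mathcal U\in\mathcal C^o_{\mathcal E}$) if it is the restriction to $\mathcal E$ of a finite measurable cover of $\Omega\times X$ all of whose $\omega$-sections are open in $X$. A *partition* is a cover with pairwise disjoint elements; $\mathcal P_{\mathcal E}$ denotes the finite measurable partitions of $\mathcal E$. $\mathcal R\succeq\mathcal U$ means that each element of $\mathcal R$ lies in an element of $\mathcal U$; $\mathcal U_0^{n-1}=\bigvee_{i=0}^{n-1}\Theta^{-i}\mathcal U$; and $A(\omega)=\{x\in\mathcal E_\omega:(\omega,x)\in A\}$, $\mathcal U(\omega)=\{U(\omega):U\in\mathcal U\}$. **Entropies.** They take values in $[0,\infty]$, and the limits exist by subadditivity. - For a finite or countable measurable partition $\mathcal R=\{R_i\}$ of $\mathcal E$, $$H_\mu(\mathcal R\mid\mathcal F_{\mathcal E})=\int -\sum_i\mu_\omega(R_i(\omega))\log\mu_\omega(R_i(\omega))\,dP(\omega),$$ and $h^{(r)}_\mu(T)=\sup_{\mathcal Q}\lim_{n\to\infty}\frac1nH_\mu(\mathcal Q_0^{n-1}\mid\mathcal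 F_{\mathcal E})$, the supremum being over all finite or countable measurable partitions $\mathcal Q$ of $\mathcal E$ with $H_\mu(\mathcal Q\mid\mathcal F_{\mathcal E})<\infty$. - For $\mathcal U\in\mathcal C_{\mathcal E}$, $H_\mu(\mathcal U\mid\mathcal F_{\mathcal E})=\inf\{H_\mu(\mathcal R\mid\mathcal F_{\mathcal E}):\mathcal R\in\mathcal P_{\mathcal E},\ \mathcal R\succeq\mathcal U\}$ and $h^{(r)-}_\mu(T,\mathcal U)=\lim_{n\to\infty}\frac1nH_\mu(\mathcal U_0^{n-1}\mid\mathcal F_{\mathcal E})$. - For $\mathcal U\in\mathcal C_{\mathcal E}$, let $N(T,\omega,\mathcal U,n)$ be the least cardinality of a subfamily of $\bigvee_{i=0}^{n-1}(T^i_\omega)^{-1}\mathcal U(\vartheta^i\omega)$ that covers $\mathcal E_\omega$, and $h_{\mathrm{top}}(T,\mathcal U)=\lim_{n\to\infty}\frac1n\int\log N(T,\omega,\mathcal U,n)\,dP(\omega)$. **Claim.** 1. $h^{(r)}_\mu(T)=\sup_{\mathcal U\in\mathcal C^o_{\mathcal E}}h^{(r)-}_\mu(T,\mathcal U)$; 2.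 $h^{(r)-}_\mu(T,\mathcal U)\le h_{\mathrm{top}}(T,\mathcal U)$ for every cover $\mathcal U\in\mathcal C_{\mathcal E}$. -/

import Mathlib

open MeasureTheory ProbabilityTheory Filter Set
open scoped ENNReal

noncomputable section

/-- A (measurable) bundle random dynamical system over a transformation `ϑ` of `Ω`: a product
measurable set `E ⊆ Ω × X` with compact fibres `E_ω`, and maps `T_ω : E_ω → E_{ϑ ω}` such that
`(ω, x) ↦ T_ω x` is measurable on `E`. -/
structure BundleRDS {Ω : Type*} [MeasurableSpace Ω] (ϑ : Ω → Ω)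
    (X : Type*) [TopologicalSpace X] [MeasurableSpace X] where
  E : Set (Ω × X)
  measurableSet_E : MeasurableSet E
  isCompact_fiber : ∀ ω, IsCompact {x : X | (ω, x) ∈ E}
  T : ∀ ω, {x : X // (ω, x) ∈ E} → {x : X // (ϑ ω, x) ∈ E}
  measurable_T : Measurable fun p : E => (T p.1.1 ⟨p.1.2, p.2⟩ : X)

/-- A finite or countable family of measurable sets that covers the whole space. -/
def IsMeasurableCover {α ι : Type*} [MeasurableSpace α] (U : ι → Set α) : Prop :=
  (∀ i, MeasurableSet (U i)) ∧ ⋃ i, U i = univ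

/-- A measurable cover with pairwise disjoint elements (some of them may be empty). -/
def IsMeasurablePartition {α ι : Type*} [MeasurableSpace α] (R : ι → Set α) : Prop :=
  IsMeasurableCover R ∧ Pairwise fun i j => Disjoint (R i) (R j)

/-- `R` is finer than `U`: each element of `R` is contained in some element of `U`. -/
def IsFiner {α ι κ : Type*} (R : ι → Set α) (U : κ → Set α) : Prop :=
  ∀ i, ∃ j, R i ⊆ U j

namespace BundleRDS

variable {Ω : Type*} [MeasurableSpace Ω] {ϑ : Ω → Ω}
  {X : Type*} [TopologicalSpace X] [MeasurableSpace X]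

/-- The bundle RDS is homeomorphic: `T_ω : E_ω → E_{ϑ ω}` is a homeomorphism for `P`-almost
every `ω`. -/
def IsHomeomorphic (T : BundleRDS ϑ X) (P : Measure Ω) : Prop :=
  ∀ᵐ ω ∂P, IsHomeomorph (T.T ω)

/-- The skew product `Θ (ω, x) = (ϑ ω, T_ω x)` on `E`. -/
def skew (T : BundleRDS ϑ X) (p : T.E) : T.E :=
  ⟨(ϑ p.1.1, T.T p.1.1 ⟨p.1.2, p.2⟩), (T.T p.1.1 ⟨p.1.2, p.2⟩).2⟩

/-- The iterates `T_ω^n = T_{ϑ^{n-1} ω} ∘ ⋯ ∘ T_ω : E_ω → E_{ϑ^n ω}`. -/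
def iter (T : BundleRDS ϑ X) :
    (n : ℕ) → (ω : Ω) → {x : X // (ω, x) ∈ T.E} → {x : X // (ϑ^[n] ω, x) ∈ T.E}
  | 0, _, x => x
  | n + 1, ω, x => iter T n (ϑ ω) (T.T ω x)

theorem skew_iterate (T : BundleRDS ϑ X) (n : ℕ) (ω : Ω) (x : {x : X // (ω, x) ∈ T.E}) :
    T.skew^[n] ⟨(ω, x.1), x.2⟩ = ⟨(ϑ^[n] ω, (T.iter n ω x).1), (T.iter n ω x).2⟩ := by
  induction n generalizing ω with
  | zero => rfl
  | succ n ih => exact ih (ϑ ω) (T.T ω x)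

/-- The section `A(ω) ⊆ E_ω` of a subset `A` of `E`. -/
def fiberSet (T : BundleRDS ϑ X) (A : Set T.E) (ω : Ω) : Set {x : X // (ω, x) ∈ T.E} :=
  {x | (⟨(ω, x.1), x.2⟩ : T.E) ∈ A}

/-- An open cover of `E`: the restriction to `E` of a measurable cover of `Ω × X` all of whose
sections are open in `X`. -/
def IsOpenCover (T : BundleRDS ϑ X) {ι : Type*} (U : ι → Set T.E) : Prop :=
  ∃ V : ι → Set (Ω × X), IsMeasurableCover V ∧ (∀ i ω, IsOpen {x : X | (ω, x) ∈ V i}) ∧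
    ∀ i, U i = Subtype.val ⁻¹' V i

/-- The join `U_0^{n-1} = ⋁_{i=0}^{n-1} Θ^{-i} U`, indexed by words of length `n`. -/
def join (T : BundleRDS ϑ X) {ι : Type*} (U : ι → Set T.E) (n : ℕ) :
    (Fin n → ι) → Set T.E :=
  fun s => ⋂ i : Fin n, T.skew^[(i : ℕ)] ⁻¹' U (s i)

/-- `N(T, ω, U, n)`: the least cardinality of a subfamily of
`⋁_{i=0}^{n-1} (T_ω^i)^{-1} U(ϑ^i ω)` that covers `E_ω`. -/
def coverNumber (T : BundleRDS ϑ X) {ι : Type*} (U : ι → Set T.E) (n : ℕ) (ω : Ω) : ℕ :=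
  sInf {m : ℕ | ∃ F : Finset (Fin n → ι), F.card = m ∧
    ⋃ s ∈ F, ⋂ i : Fin n, T.iter i ω ⁻¹' T.fiberSet (U (s i)) (ϑ^[(i : ℕ)] ω) = univ}

/-- `H(T, U, n) = ∫ log N(T, ω, U, n) dP(ω)`. -/
def topH (T : BundleRDS ϑ X) (P : Measure Ω) {ι : Type*} (U : ι → Set T.E) (n : ℕ) : ℝ≥0∞ :=
  ∫⁻ ω, ENNReal.ofReal (Real.log (T.coverNumber U n ω)) ∂P

/-- The random topological entropy of a cover, `lim_n H(T, U, n) / n` (a limit by subadditivity,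
written as an upper limit). -/
def hTop (T : BundleRDS ϑ X) (P : Measure Ω) {ι : Type*} (U : ι → Set T.E) : ℝ≥0∞ :=
  limsup (fun n : ℕ => T.topH P U n / n) atTop

/-- `μ` is a `Θ`-invariant measure on `Ω × X` with marginal `P` on `Ω` and `μ(E) = 1`. -/
structure IsInvariant (T : BundleRDS ϑ X) (P : Measure Ω) (μ : Measure (Ω × X)) : Prop where
  fst_eq : μ.fst = P
  measure_E : μ T.E = 1
  invariant : MeasurePreserving T.skew (μ.comap Subtype.val) (μ.comap Subtype.val)

section entropy

variable [StandardBorelSpace X] [Nonempty X]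

/-- The conditional entropy `H_μ(R | F_E) = ∫ H_{μ_ω}(R(ω)) dP(ω)` of a finite or countable
partition `R` of `E`, where `μ_ω = μ.condKernel ω` is the disintegration
`dμ(ω, x) = dμ_ω(x) dP(ω)`. -/
def partitionH (T : BundleRDS ϑ X) (P : Measure Ω) (μ : Measure (Ω × X)) [IsFiniteMeasure μ]
    {ι : Type*} (R : ι → Set T.E) : ℝ≥0∞ :=
  ∫⁻ ω, ∑' i, ENNReal.ofReal
    (Real.negMulLog ((μ.condKernel ω).real (Subtype.val '' T.fiberSet (R i) ω))) ∂P

/-- `h_μ^{(r)}(T, Q) = lim_n H_μ(⋁_{i=0}^{n-1} Θ^{-i} Q | F_E) / n` (a limit by subadditivity,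
written as an upper limit). -/
def hPartition (T : BundleRDS ϑ X) (P : Measure Ω) (μ : Measure (Ω × X)) [IsFiniteMeasure μ]
    {ι : Type*} (Q : ι → Set T.E) : ℝ≥0∞ :=
  limsup (fun n : ℕ => T.partitionH P μ (T.join Q n) / n) atTop

/-- The random measure-theoretical entropy `h_μ^{(r)}(T)`: the supremum over all finite or
countable measurable partitions of `E` of finite conditional entropy (a finite partition is
listed with empty sets added). -/
def hMeas (T : BundleRDS ϑ X) (P : Measure Ω) (μ : Measure (Ω × X)) [IsFiniteMeasure μ] : ℝ≥0∞ :=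
  ⨆ (Q : ℕ → Set T.E) (_ : IsMeasurablePartition Q) (_ : T.partitionH P μ Q < ∞),
    T.hPartition P μ Q

/-- `H_μ(U | F_E)` for a cover `U` of `E`: the infimum of `H_μ(R | F_E)` over the finite
measurable partitions `R` of `E` that are finer than `U`. -/
def coverH (T : BundleRDS ϑ X) (P : Measure Ω) (μ : Measure (Ω × X)) [IsFiniteMeasure μ]
    {ι : Type*} (U : ι → Set T.E) : ℝ≥0∞ :=
  ⨅ (k : ℕ) (R : Fin k → Set T.E) (_ : IsMeasurablePartition R) (_ : IsFiner R U),
    T.partitionH P μ R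

/-- `h_μ^{(r)-}(T, U) = lim_n H_μ(U_0^{n-1} | F_E) / n` for a cover `U` of `E` (a limit by
subadditivity, written as an upper limit). -/
def hMinus (T : BundleRDS ϑ X) (P : Measure Ω) (μ : Measure (Ω × X)) [IsFiniteMeasure μ]
    {ι : Type*} (U : ι → Set T.E) : ℝ≥0∞ :=
  limsup (fun n : ℕ => T.coverH P μ (T.join U n) / n) atTop

end entropy

end BundleRDS

end

/-! To bound `hMeas` by open covers, take a countable partition Q of finite entropy and, inside
finitely many of its cells, sets K_a with closed sections that fill E up to a set D of small
measure. The complements U_b of the unions of the K_a with a ≠ b form an open cover, and off D the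
element U_b determines the cell of Q. So a partition R finer than the n-fold join of U predicts the
Q-word of a point except at its visits to D. Encode each letter with weight 1 - t on the prediction
and weight t spread like the conditional distribution of Q. By Gibbs' inequality
(`tsum_mul_surprisal_le_add`) the entropy beyond that of R is at most the expected code length,
which by invariance is at most n times -log(1 - t) + ∫_D (-log t + I_Q), with I_Q the information
function (`partitionH_join_le`). Since I_Q is integrable, this rate is small once t and then D are
small, uniformly in n and R, so the infimum over R can be taken.

Conversely, a measurable choice of cover elements gives a finite partition whose joins refine those
of the cover. For the topological bound, the choice is made within a smallest subfamily covering
μ_ω-almost all of the fibre; the resulting partition has at most N(ω) cells of positive mass there,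
hence fibre entropy at most log N(ω) (`coverH_le_lintegral`). -/

noncomputable section

/-! ### Information content and Gibbs' inequality. -/

/-- The information `-log p` of an event of probability `p`, with value `∞` at `p = 0`. -/
def surprisal (p : ℝ≥0∞) : ℝ≥0∞ :=
  if p = 0 then ∞ else ENNReal.ofReal (-Real.log p.toReal)

theorem surprisal_one : surprisal 1 = 0 := by simp [surprisal]

theorem surprisal_ne_top {p : ℝ≥0∞} (hp : p ≠ 0) : surprisal p ≠ ∞ := by
  simp [surprisal, hp]

theorem measurable_surprisal : Measurable surprisal :=
  Measurable.ite (measurableSet_singleton 0) measurable_const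
    (Real.measurable_log.comp ENNReal.measurable_toReal).neg.ennreal_ofReal

theorem surprisal_anti {p q : ℝ≥0∞} (h : p ≤ q) : surprisal q ≤ surprisal p := by
  rcases eq_or_ne p 0 with rfl | hp
  · simp [surprisal]
  have hq : q ≠ 0 := fun h0 => hp (by simpa [h0] using h)
  rcases eq_or_ne q ∞ with rfl | hq'
  · simp [surprisal]
  have hp' : p ≠ ∞ := ne_top_of_le_ne_top hq' h
  simp only [surprisal, hp, hq, if_false]
  refine ENNReal.ofReal_le_ofReal (neg_le_neg (Real.log_le_log (ENNReal.toReal_pos hp hp') ?_))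
  exact ENNReal.toReal_mono hq' h

theorem surprisal_mul_le (p q : ℝ≥0∞) (hp1 : p ≤ 1) (hq1 : q ≤ 1) :
    surprisal (p * q) ≤ surprisal p + surprisal q := by
  rcases eq_or_ne p 0 with rfl | hp
  · simp [surprisal]
  rcases eq_or_ne q 0 with rfl | hq
  · simp [surprisal]
  have hp' : p ≠ ∞ := ne_top_of_le_ne_top ENNReal.one_ne_top hp1
  have hq' : q ≠ ∞ := ne_top_of_le_ne_top ENNReal.one_ne_top hq1
  simp only [surprisal, hp, hq, mul_eq_zero, or_self, if_false, ENNReal.toReal_mul]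
  rw [Real.log_mul (ENNReal.toReal_pos hp hp').ne' (ENNReal.toReal_pos hq hq').ne', neg_add]
  exact ENNReal.ofReal_add_le

theorem surprisal_prod_le {ι : Type*} (s : Finset ι) (f : ι → ℝ≥0∞) (hf : ∀ i, f i ≤ 1) :
    surprisal (∏ i ∈ s, f i) ≤ ∑ i ∈ s, surprisal (f i) := by
  classical
  induction s using Finset.induction_on with
  | empty => simp [surprisal_one]
  | insert a s ha ih =>
    rw [Finset.prod_insert ha, Finset.sum_insert ha]
    exact (surprisal_mul_le _ _ (hf a) (Finset.prod_le_one' fun i _ => hf i)).trans (by gcongr)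

/-- Makes entropy an expected `surprisal`; the infinite value at 0 is harmless because 0 * ∞ = 0. -/
theorem ofReal_negMulLog_toReal {p : ℝ≥0∞} (hp : p ≠ ∞) :
    ENNReal.ofReal (Real.negMulLog p.toReal) = p * surprisal p := by
  rcases eq_or_ne p 0 with rfl | h0
  · simp
  rw [surprisal, if_neg h0, Real.negMulLog, neg_mul_comm,
    ENNReal.ofReal_mul ENNReal.toReal_nonneg, ENNReal.ofReal_toReal hp]

/-- The pointwise form of Gibbs' inequality. -/
theorem mul_surprisal_add_le {p w : ℝ≥0∞} (hp : p ≤ 1) (hw : w ≤ 1) :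
    p * surprisal p + p ≤ p * surprisal w + w := by
  rcases eq_or_ne p 0 with rfl | hp0
  · simp
  rcases eq_or_ne w 0 with rfl | hw0
  · simp [surprisal, hp0]
  have hp' : p ≠ ∞ := ne_top_of_le_ne_top ENNReal.one_ne_top hp
  have hw' : w ≠ ∞ := ne_top_of_le_ne_top ENNReal.one_ne_top hw
  lift p to NNReal using hp'
  lift w to NNReal using hw'
  have hp0' : 0 < (p : ℝ) := by
    exact_mod_cast pos_iff_ne_zero.2 (by exact_mod_cast hp0)
  have hw0' : 0 < (w : ℝ) := by
    exact_mod_cast pos_iff_ne_zero.2 (by exact_mod_cast hw0)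
  have hp1 : (p : ℝ) ≤ 1 := by exact_mod_cast hp
  have hw1 : (w : ℝ) ≤ 1 := by exact_mod_cast hw
  have lp : 0 ≤ -Real.log p := neg_nonneg.2 (Real.log_nonpos hp0'.le hp1)
  have lw : 0 ≤ -Real.log w := neg_nonneg.2 (Real.log_nonpos hw0'.le hw1)
  have key : (p : ℝ) * -Real.log p + p ≤ p * -Real.log w + w := by
    have h := Real.log_le_sub_one_of_pos (div_pos hw0' hp0')
    rw [Real.log_div hw0'.ne' hp0'.ne'] at h
    have h2 := mul_le_mul_of_nonneg_left h hp0'.le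
    have h3 : (p : ℝ) * (w / p - 1) = w - p := by field_simp
    linarith
  simp only [surprisal, hp0, hw0, if_false, ENNReal.coe_toReal]
  rw [← ENNReal.ofReal_coe_nnreal (p := p), ← ENNReal.ofReal_coe_nnreal (p := w),
    ← ENNReal.ofReal_mul hp0'.le, ← ENNReal.ofReal_mul hp0'.le, ← ENNReal.ofReal_add (by positivity)
    hp0'.le, ← ENNReal.ofReal_add (by positivity) hw0'.le]
  exact ENNReal.ofReal_le_ofReal key

/-- Gibbs' inequality: the entropy of a probability vector is at most its cross entropy with
respect to a sub-probability vector. -/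
theorem tsum_mul_surprisal_le {ι : Type*} {p w : ι → ℝ≥0∞} (hp : ∑' i, p i = 1)
    (hw : ∑' i, w i ≤ 1) :
    ∑' i, p i * surprisal (p i) ≤ ∑' i, p i * surprisal (w i) := by
  -- Adding the total mass 1 to both sides avoids subtraction in `ℝ≥0∞`.
  refine (ENNReal.add_le_add_iff_right ENNReal.one_ne_top).1 ?_
  calc ∑' i, p i * surprisal (p i) + 1
      = ∑' i, (p i * surprisal (p i) + p i) := by rw [ENNReal.tsum_add, hp]
    _ ≤ ∑' i, (p i * surprisal (w i) + w i) := ENNReal.tsum_le_tsum fun i =>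
        mul_surprisal_add_le ((ENNReal.le_tsum i).trans hp.le) ((ENNReal.le_tsum i).trans hw)
    _ ≤ ∑' i, p i * surprisal (w i) + 1 := by rw [ENNReal.tsum_add]; gcongr

/-- The entropy of the first marginal of a joint distribution `p` is at most the entropy of the
second marginal plus the expected information of a family of conditional weights. -/
theorem tsum_mul_surprisal_le_add {S J : Type*} (p : S → J → ℝ≥0∞) (hp : ∑' s, ∑' j, p s j = 1)
    (w : J → S → ℝ≥0∞) (hw : ∀ j, ∑' s, w j s ≤ 1) :
    ∑' s, (∑' j, p s j) * surprisal (∑' j, p s j) ≤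
      ∑' j, (∑' s, p s j) * surprisal (∑' s, p s j) +
        ∑' s, ∑' j, p s j * surprisal (w j s) := by
  have hp' : ∑' x : S × J, p x.1 x.2 = 1 := by rw [ENNReal.tsum_prod, hp]
  -- The comparison vector for Gibbs' inequality on S × J: the second marginal times the conditional
  -- weights.
  have hsw : ∑' x : S × J, (∑' s, p s x.2) * w x.2 x.1 ≤ 1 := by
    rw [ENNReal.tsum_prod' (f := fun x : S × J => (∑' s, p s x.2) * w x.2 x.1), ENNReal.tsum_comm]
    calc _ = ∑' j, (∑' s, p s j) * ∑' s, w j s := by simp_rw [ENNReal.tsum_mul_left]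
      _ ≤ ∑' j, (∑' s, p s j) * 1 := by gcongr with j; exact hw j
      _ = 1 := by simp_rw [mul_one]; rw [ENNReal.tsum_comm, hp]
  have hj : ∀ j, ∑' s, p s j ≤ 1 := fun j => by
    rw [ENNReal.tsum_comm] at hp
    exact (ENNReal.le_tsum j).trans hp.le
  calc ∑' s, (∑' j, p s j) * surprisal (∑' j, p s j)
      ≤ ∑' s, ∑' j, p s j * surprisal (p s j) := by
        gcongr with s
        rw [← ENNReal.tsum_mul_right]
        gcongr with j
        exact surprisal_anti (ENNReal.le_tsum j)
    _ = ∑' x : S × J, p x.1 x.2 * surprisal (p x.1 x.2) := by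
        rw [ENNReal.tsum_prod (f := fun s j => p s j * surprisal (p s j))]
    _ ≤ ∑' x : S × J, p x.1 x.2 * surprisal ((∑' s, p s x.2) * w x.2 x.1) :=
        tsum_mul_surprisal_le hp' hsw
    _ ≤ ∑' x : S × J, (p x.1 x.2 * surprisal (∑' s, p s x.2) + p x.1 x.2 * surprisal (w x.2 x.1)) := by
        gcongr with x
        rw [← mul_add]
        gcongr
        exact surprisal_mul_le _ _ (hj _) ((ENNReal.le_tsum _).trans (hw _))
    _ = _ := by
        rw [ENNReal.tsum_add, ENNReal.tsum_prod (f := fun s j => p s j * surprisal (∑' s, p s j)),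
          ENNReal.tsum_prod (f := fun s j => p s j * surprisal (w j s)), ENNReal.tsum_comm]
        simp_rw [ENNReal.tsum_mul_right]

/-- Splitting off the first letter gives an induction. This makes a product of one-letter codes
admissible in Gibbs' inequality for words. -/
theorem tsum_pi_prod_le_one {ι : Type*} (n : ℕ) (f : Fin n → ι → ℝ≥0∞)
    (hf : ∀ i, ∑' a, f i a ≤ 1) : ∑' s : Fin n → ι, ∏ i, f i (s i) ≤ 1 := by
  induction n with
  | zero => simp
  | succ n ih =>
    rw [← (Fin.consEquiv fun _ => ι).tsum_eq, ENNReal.tsum_prod']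
    simp only [Fin.consEquiv_apply, Fin.prod_univ_succ, Fin.cons_zero, Fin.cons_succ,
      ENNReal.tsum_mul_left]
    calc ∑' a, f 0 a * ∑' s : Fin n → ι, ∏ i, f i.succ (s i)
        ≤ ∑' a, f 0 a * 1 := by gcongr; exact ih _ fun i => hf _
      _ ≤ 1 := by simpa using hf 0

/-- By continuity of the logarithm at 1, reserving a weight t for wrong predictions costs little
when the prediction is right; t ≠ 0 keeps the cost of a wrong one finite. -/
theorem exists_surprisal_one_sub_lt {ε : ℝ≥0∞} (hε : ε ≠ 0) :
    ∃ t : ℝ≥0∞, t ≠ 0 ∧ t ≤ 1 ∧ surprisal (1 - t) < ε := by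
  have hc : ContinuousAt (fun x : ℝ => ENNReal.ofReal (-Real.log (1 - x))) 0 := by
    refine ENNReal.continuous_ofReal.continuousAt.comp ?_
    exact ((Real.continuousAt_log (by simp)).comp (by fun_prop)).neg
  have h0 : ENNReal.ofReal (-Real.log (1 - 0)) < ε := by simpa using pos_iff_ne_zero.2 hε
  have h1 := (hc.eventually_lt continuousAt_const h0).filter_mono
    (nhdsWithin_le_nhds (s := Ioi 0))
  obtain ⟨x, hx, hx0, hx1⟩ := (h1.and (Ioo_mem_nhdsGT (zero_lt_one' ℝ))).exists
  have e : 1 - ENNReal.ofReal x = ENNReal.ofReal (1 - x) := by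
    rw [ENNReal.ofReal_sub _ hx0.le, ENNReal.ofReal_one]
  refine ⟨ENNReal.ofReal x, by simpa using hx0, by simpa using hx1.le, ?_⟩
  rw [e, surprisal, if_neg (by simpa using hx1), ENNReal.toReal_ofReal (by linarith)]
  exact hx

/-! ### Measurable choice and approximation by sets with closed or open sections. -/

/-- A measurable cover by finitely many sets admits a measurable choice of an element of the cover
containing a given point, with preference for a measurably varying subfamily. -/
theorem exists_measurable_choice {α ι : Type*} [MeasurableSpace α] [Finite ι] [MeasurableSpace ι]
    {U : ι → Set α} (hU : IsMeasurableCover U) {F : α → Set ι} (hF : Measurable F) :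
    ∃ l : α → ι, Measurable l ∧ (∀ z, z ∈ U (l z)) ∧
      ∀ z, (∃ i ∈ F z, z ∈ U i) → l z ∈ F z := by
  classical
  rcases isEmpty_or_nonempty ι with hι | hι
  · have : IsEmpty α := by
      rw [← univ_eq_empty_iff, ← hU.2]; simp
    exact ⟨fun z => isEmptyElim z, measurable_of_empty _, fun z => isEmptyElim z,
      fun z => isEmptyElim z⟩
  have hA : Measurable fun z => {i | z ∈ U i} :=
    measurable_set_iff.2 fun i => measurable_mem.2 (hU.1 i)
  -- The choice depends on z only through two subsets of a finite set, so its measurability is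
  -- automatic.
  let c : Set ι × Set ι → ι := fun p =>
    if h : (p.1 ∩ p.2).Nonempty then h.some else if h : p.2.Nonempty then h.some else
      Classical.arbitrary ι
  have hne : ∀ z, {i | z ∈ U i}.Nonempty := fun z => by
    have : z ∈ ⋃ i, U i := hU.2 ▸ mem_univ z
    exact mem_iUnion.1 this
  refine ⟨fun z => c (F z, {i | z ∈ U i}), (Measurable.of_discrete (f := c)).comp (hF.prodMk hA),
    fun z => ?_, fun z ⟨i, hi, hzi⟩ => ?_⟩
  · by_cases h : (F z ∩ {i | z ∈ U i}).Nonempty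
    · simp only [c, h, dif_pos]; exact h.some_mem.2
    · simp only [c, h, dif_neg, not_false_eq_true, hne z, dif_pos]; exact (hne z).some_mem
  · have h : (F z ∩ {i | z ∈ U i}).Nonempty := ⟨i, hi, hzi⟩
    simp only [c, h, dif_pos]; exact h.some_mem.1

theorem isMeasurablePartition_preimage {α ι : Type*} [MeasurableSpace α] [MeasurableSpace ι]
    [MeasurableSingletonClass ι] {l : α → ι} (hl : Measurable l) :
    IsMeasurablePartition fun i => l ⁻¹' {i} := by
  refine ⟨⟨fun i => hl (measurableSet_singleton i), ?_⟩, fun i j hij => ?_⟩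
  · ext z; simp
  · exact Disjoint.preimage _ (by simpa using hij)

theorem exists_measure_iUnion_diff_lt {α : Type*} [MeasurableSpace α] (μ : Measure α)
    [IsFiniteMeasure μ] {f : ℕ → Set α} (hf : ∀ i, MeasurableSet (f i)) {ε : ℝ≥0∞} (hε : ε ≠ 0) :
    ∃ n, μ ((⋃ i, f i) \ ⋃ i ∈ Finset.range n, f i) < ε := by
  have h := tendsto_measure_iInter_atTop (μ := μ)
    (s := fun n => (⋃ i, f i) \ ⋃ i ∈ Finset.range n, f i)
    (fun n => ((MeasurableSet.iUnion hf).diff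
      (Finset.measurableSet_biUnion _ fun i _ => hf i)).nullMeasurableSet)
    (fun a b hab => sdiff_le_sdiff_left
      (biUnion_subset_biUnion_left fun i hi => Finset.range_mono hab hi))
    ⟨0, measure_ne_top _ _⟩
  have he : ⋂ n, ((⋃ i, f i) \ ⋃ i ∈ Finset.range n, f i) = ∅ := by
    refine eq_empty_of_forall_notMem fun z hz => ?_
    rw [mem_iInter] at hz
    obtain ⟨i, hi⟩ := mem_iUnion.1 (hz 0).1
    exact (hz (i + 1)).2 (mem_biUnion (Finset.self_mem_range_succ i) hi)
  rw [he, measure_empty] at h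
  exact (h.eventually_lt_const (pos_iff_ne_zero.2 hε)).exists

/-- Measurable subsets of a product are approximated by measurable sets with closed sections from
inside and by measurable sets with open sections from outside. -/
theorem exists_closed_sections_open_sections {Ω X : Type*} [MeasurableSpace Ω] [MetricSpace X]
    [MeasurableSpace X] [BorelSpace X] (μ : Measure (Ω × X)) [IsFiniteMeasure μ]
    {A : Set (Ω × X)} (hA : MeasurableSet A) :
    ∀ ε : ℝ≥0∞, ε ≠ 0 →
      (∃ K ⊆ A, MeasurableSet K ∧ (∀ ω, IsClosed {x | (ω, x) ∈ K}) ∧ μ (A \ K) < ε) ∧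
      ∃ O, A ⊆ O ∧ MeasurableSet O ∧ (∀ ω, IsOpen {x | (ω, x) ∈ O}) ∧ μ (O \ A) < ε := by
  -- Dynkin's π-λ argument from rectangles. Both approximations are carried together because
  -- complementation exchanges them.
  induction A, hA using MeasurableSpace.induction_on_inter generateFrom_prod.symm isPiSystem_prod with
  | empty =>
    exact fun ε hε => ⟨⟨∅, by simp, by simp, by simp, by simpa using pos_iff_ne_zero.2 hε⟩,
      ∅, by simp, by simp, by simp, by simpa using pos_iff_ne_zero.2 hε⟩
  | basic t ht =>
    obtain ⟨F, hF, C, hC, rfl⟩ := ht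
    intro ε hε
    obtain ⟨K, hKC, hK, hKε⟩ := MeasurableSet.exists_isClosed_sdiff_lt (μ := μ.snd) hC (measure_ne_top _ _) hε
    obtain ⟨O, hCO, hO, -, hOε⟩ := MeasurableSet.exists_isOpen_sdiff_lt (μ := μ.snd) hC (measure_ne_top _ _) hε
    refine ⟨⟨F ×ˢ K, prod_mono le_rfl hKC, hF.prod hK.measurableSet, fun ω => ?_, ?_⟩,
      F ×ˢ O, prod_mono le_rfl hCO, hF.prod hO.measurableSet, fun ω => ?_, ?_⟩
    · by_cases h : ω ∈ F <;> simp [h, hK]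
    · rw [Measure.snd_apply (hC.diff hK.measurableSet)] at hKε
      refine (measure_mono ?_).trans_lt hKε
      rintro ⟨ω, x⟩ ⟨⟨h1, h2⟩, h3⟩
      exact ⟨h2, fun h => h3 ⟨h1, h⟩⟩
    · by_cases h : ω ∈ F <;> simp [h, hO]
    · rw [Measure.snd_apply (hO.measurableSet.diff hC)] at hOε
      refine (measure_mono ?_).trans_lt hOε
      rintro ⟨ω, x⟩ ⟨⟨h1, h2⟩, h3⟩
      exact ⟨h2, fun h => h3 ⟨h1, h⟩⟩
  | compl t ht ih =>
    intro ε hε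
    obtain ⟨⟨K, hKt, hK, hKc, hKε⟩, O, htO, hO, hOo, hOε⟩ := ih ε hε
    refine ⟨⟨Oᶜ, compl_subset_compl.2 htO, hO.compl, fun ω => (hOo ω).isClosed_compl, ?_⟩,
      Kᶜ, compl_subset_compl.2 hKt, hK.compl, fun ω => (hKc ω).isOpen_compl, ?_⟩
    · rwa [compl_sdiff_compl]
    · rwa [compl_sdiff_compl]
  | iUnion f hd hf ih =>
    intro ε hε
    have hε2 : ε / 2 ≠ 0 := by simpa using hε
    obtain ⟨δ, hδ, hδε⟩ := ENNReal.exists_pos_sum_of_countable' hε2 ℕ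
    choose hKex hOex using fun i => ih i (δ i) (hδ i).ne'
    choose K hKf hK hKc hKδ using hKex
    choose O hfO hO hOo hOδ using hOex
    constructor
    -- Only finite unions keep sections closed, so the tail of the union is discarded first.
    · obtain ⟨n, hn⟩ := exists_measure_iUnion_diff_lt μ hf hε2
      refine ⟨⋃ i ∈ Finset.range n, K i, ?_, Finset.measurableSet_biUnion _ fun i _ => hK i,
        fun ω => ?_, ?_⟩
      · exact iUnion₂_subset fun i _ => (hKf i).trans (subset_iUnion f i)
      · have : {x | (ω, x) ∈ ⋃ i ∈ Finset.range n, K i} =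
            ⋃ i ∈ Finset.range n, {x | (ω, x) ∈ K i} := by ext; simp
        rw [this]
        exact isClosed_biUnion_finset fun i _ => hKc i ω
      · calc μ ((⋃ i, f i) \ ⋃ i ∈ Finset.range n, K i)
            ≤ μ (((⋃ i, f i) \ ⋃ i ∈ Finset.range n, f i) ∪ ⋃ i, (f i \ K i)) := by
              refine measure_mono fun z hz => ?_
              by_cases h : z ∈ ⋃ i ∈ Finset.range n, f i
              · right
                simp only [mem_iUnion] at h ⊢
                obtain ⟨i, hi, hzi⟩ := h
                exact ⟨i, hzi, fun hK => hz.2 (mem_biUnion hi hK)⟩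
              · exact Or.inl ⟨hz.1, h⟩
          _ ≤ μ ((⋃ i, f i) \ ⋃ i ∈ Finset.range n, f i) + ∑' i, μ (f i \ K i) :=
              (measure_union_le _ _).trans (by gcongr; exact measure_iUnion_le _)
          _ < ε / 2 + ε / 2 := ENNReal.add_lt_add hn
              ((ENNReal.tsum_le_tsum fun i => (hKδ i).le).trans_lt hδε)
          _ = ε := ENNReal.add_halves ε
    · refine ⟨⋃ i, O i, iUnion_mono hfO, .iUnion hO, fun ω => ?_, ?_⟩
      · have : {x | (ω, x) ∈ ⋃ i, O i} = ⋃ i, {x | (ω, x) ∈ O i} := by ext; simp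
        rw [this]
        exact isOpen_iUnion fun i => hOo i ω
      · calc μ ((⋃ i, O i) \ ⋃ i, f i) ≤ μ (⋃ i, (O i \ f i)) := by
              refine measure_mono fun z hz => ?_
              obtain ⟨i, hi⟩ := mem_iUnion.1 hz.1
              exact mem_iUnion.2 ⟨i, hi, fun h => hz.2 (mem_iUnion.2 ⟨i, h⟩)⟩
          _ ≤ ∑' i, μ (O i \ f i) := measure_iUnion_le _
          _ ≤ ∑' i, δ i := ENNReal.tsum_le_tsum fun i => (hOδ i).le
          _ < ε := hδε.trans_le ENNReal.half_le_self


/-! ### Joins, and sums over the cells of a partition. -/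

theorem isMeasurableCover_join {Ω : Type*} [MeasurableSpace Ω] {ϑ : Ω → Ω}
    {X : Type*} [TopologicalSpace X] [MeasurableSpace X] (T : BundleRDS ϑ X)
    (hT : Measurable T.skew) {ι : Type*} {U : ι → Set T.E} (hU : IsMeasurableCover U) (n : ℕ) :
    IsMeasurableCover (T.join U n) := by
  refine ⟨fun s => MeasurableSet.iInter fun i => hT.iterate i (hU.1 _), ?_⟩
  refine eq_univ_of_forall fun z => ?_
  have h : ∀ i : Fin n, ∃ j, T.skew^[i] z ∈ U j := fun i => by
    have : T.skew^[i] z ∈ ⋃ j, U j := hU.2 ▸ mem_univ _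
    exact mem_iUnion.1 this
  choose s hs using h
  exact mem_iUnion.2 ⟨s, mem_iInter.2 hs⟩

theorem isMeasurablePartition_join {Ω : Type*} [MeasurableSpace Ω] {ϑ : Ω → Ω}
    {X : Type*} [TopologicalSpace X] [MeasurableSpace X] (T : BundleRDS ϑ X)
    (hT : Measurable T.skew) {ι : Type*} {R : ι → Set T.E} (hR : IsMeasurablePartition R) (n : ℕ) :
    IsMeasurablePartition (T.join R n) := by
  refine ⟨isMeasurableCover_join T hT hR.1 n, fun s t hst => ?_⟩
  obtain ⟨i, hi⟩ := Function.ne_iff.1 hst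
  exact disjoint_left.2 fun z hs ht =>
    disjoint_left.1 (hR.2 hi) (mem_iInter.1 hs i) (mem_iInter.1 ht i)

theorem IsMeasurablePartition.tsum_measure_inter {α ι : Type*} [MeasurableSpace α] [Countable ι]
    {R : ι → Set α} (hR : IsMeasurablePartition R) (m : Measure α) {A : Set α}
    (hA : MeasurableSet A) : ∑' i, m (A ∩ R i) = m A := by
  rw [← measure_iUnion (fun i j hij => (hR.2 hij).mono inter_subset_right inter_subset_right)
    (fun i => hA.inter (hR.1.1 i)), ← inter_iUnion, hR.1.2, inter_univ]

theorem IsMeasurablePartition.tsum_measure {α ι : Type*} [MeasurableSpace α] [Countable ι]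
    {R : ι → Set α} (hR : IsMeasurablePartition R) (m : Measure α) :
    ∑' i, m (R i) = m univ := by
  simpa using hR.tsum_measure_inter m .univ

theorem IsMeasurablePartition.comp_equiv {α ι κ : Type*} [MeasurableSpace α]
    {R : ι → Set α} (hR : IsMeasurablePartition R) (e : κ ≃ ι) :
    IsMeasurablePartition (R ∘ e) :=
  ⟨⟨fun i => hR.1.1 _, by rw [← hR.1.2]; exact e.surjective.iUnion_comp R⟩,
    fun _ _ hij => hR.2 (e.injective.ne hij)⟩

/-! ### Conditional measures on the bundle and partition entropy. -/

namespace BundleRDS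

variable {Ω : Type*} [MeasurableSpace Ω] {ϑ : Ω → Ω}
  {X : Type*} [TopologicalSpace X] [MeasurableSpace X] [StandardBorelSpace X] [Nonempty X]
  (T : BundleRDS ϑ X) (P : Measure Ω) (μ : Measure (Ω × X)) [IsProbabilityMeasure μ]

/-- The conditional measure `μ_ω`, viewed as a measure on `E`. -/
def fiberMeasure (ω : Ω) : Measure T.E :=
  ((μ.condKernel ω).map (Prod.mk ω)).comap Subtype.val

omit [StandardBorelSpace X] [Nonempty X] in
theorem image_fiberSet (A : Set T.E) (ω : Ω) :
    Subtype.val '' T.fiberSet A ω = Prod.mk ω ⁻¹' (Subtype.val '' A) := by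
  ext x
  simp [fiberSet]

variable {T} in
theorem fiberMeasure_apply {A : Set T.E} (hA : MeasurableSet A) (ω : Ω) :
    T.fiberMeasure μ ω A = μ.condKernel ω (Subtype.val '' T.fiberSet A ω) := by
  rw [fiberMeasure, comap_subtype_coe_apply T.measurableSet_E, Measure.map_apply
    measurable_prodMk_left (T.measurableSet_E.subtype_image hA), image_fiberSet]

theorem fiberMeasure_le_one (A : Set T.E) (ω : Ω) : T.fiberMeasure μ ω A ≤ 1 := by
  refine (measure_mono (subset_univ A)).trans ?_
  rw [fiberMeasure_apply μ .univ]
  exact prob_le_one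

variable {T} in
theorem measurable_fiberMeasure {A : Set T.E} (hA : MeasurableSet A) :
    Measurable fun ω => T.fiberMeasure μ ω A := by
  simp_rw [fiberMeasure_apply μ hA, image_fiberSet]
  exact Kernel.measurable_kernel_prodMk_left (T.measurableSet_E.subtype_image hA)

variable {T} in
-- The disintegration formula. It turns weighted fibre masses into integrals over E, where
-- invariance under the skew product can be used.
theorem lintegral_fiberMeasure_mul {A : Set T.E} (hA : MeasurableSet A) {h : Ω → ℝ≥0∞}
    (hh : Measurable h) :
    ∫⁻ ω, T.fiberMeasure μ ω A * h ω ∂μ.fst =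
      ∫⁻ z in A, h z.1.1 ∂(μ.comap Subtype.val) := by
  have hA' := T.measurableSet_E.subtype_image hA
  have h1 : ∫⁻ z in A, h z.1.1 ∂(μ.comap Subtype.val) =
      ∫⁻ z, (Subtype.val '' A).indicator (fun z => h z.1) z ∂μ := by
    have hme : MeasurableEmbedding (Subtype.val : T.E → Ω × X) :=
      MeasurableEmbedding.subtype_coe T.measurableSet_E
    rw [lintegral_indicator hA', ← lintegral_indicator hA,
      ← lintegral_indicator hA']
    have h2 : ∀ z : T.E, A.indicator (fun z : T.E => h z.1.1) z =
        (Subtype.val '' A).indicator (fun z => h z.1) z.1 := fun z => by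
      by_cases hz : z ∈ A
      · simp [hz]
      · simp [hz]
    simp_rw [h2]
    rw [← hme.lintegral_map, hme.map_comap, Subtype.range_coe, ← lintegral_indicator T.measurableSet_E, indicator_indicator]
    congr 2
    rw [inter_eq_right.2 (Subtype.coe_image_subset _ _)]
  have hf : Measurable ((Subtype.val '' A).indicator fun z : Ω × X => h z.1) :=
    (hh.comp measurable_fst).indicator hA'
  rw [h1, ← Measure.lintegral_condKernel hf]
  refine lintegral_congr fun ω => ?_
  have h3 : ∀ x, (Subtype.val '' A).indicator (fun z => h z.1) (ω, x) =
      (Prod.mk ω ⁻¹' (Subtype.val '' A)).indicator (fun _ => h ω) x := fun x => rfl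
  simp_rw [h3]
  rw [lintegral_indicator (measurable_prodMk_left hA'), setLIntegral_const, mul_comm,
    fiberMeasure_apply μ hA, image_fiberSet]

theorem ae_fiberMeasure_univ (hE : μ T.E = 1) :
    ∀ᵐ ω ∂μ.fst, T.fiberMeasure μ ω univ = 1 := by
  have h : ∀ᵐ z ∂μ, z ∈ T.E := (prob_compl_eq_zero_iff T.measurableSet_E).2 hE
  rw [← μ.disintegrate μ.condKernel] at h
  filter_upwards [Measure.ae_ae_of_ae_compProd h] with ω hω
  rw [fiberMeasure_apply μ .univ, image_fiberSet, image_univ, Subtype.range_coe]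
  exact (prob_compl_eq_zero_iff (measurable_prodMk_left T.measurableSet_E)).1 hω

variable {T} in
theorem partitionH_eq_lintegral {ι : Type*} {R : ι → Set T.E} (hR : ∀ i, MeasurableSet (R i)) :
    T.partitionH P μ R =
      ∫⁻ ω, ∑' i, T.fiberMeasure μ ω (R i) * surprisal (T.fiberMeasure μ ω (R i)) ∂P := by
  refine lintegral_congr fun ω => tsum_congr fun i => ?_
  rw [← ofReal_negMulLog_toReal (ne_top_of_le_ne_top ENNReal.one_ne_top (T.fiberMeasure_le_one μ _ ω)),
    fiberMeasure_apply μ (hR i), Measure.real]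

theorem partitionH_comp_le {ι κ : Type*} (R : ι → Set T.E) {e : κ → ι}
    (he : Function.Injective e) : T.partitionH P μ (R ∘ e) ≤ T.partitionH P μ R :=
  lintegral_mono fun ω => ENNReal.tsum_comp_le_tsum_of_injective he fun i => ENNReal.ofReal
    (Real.negMulLog ((μ.condKernel ω).real (Subtype.val '' T.fiberSet (R i) ω)))

variable {T} in
theorem coverH_le_partitionH {ι κ : Type*} [Finite ι] {R : ι → Set T.E} {U : κ → Set T.E}
    (hR : IsMeasurablePartition R) (hRU : IsFiner R U) :
    T.coverH P μ U ≤ T.partitionH P μ R := by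
  obtain ⟨k, ⟨e⟩⟩ := Finite.exists_equiv_fin ι
  exact (iInf₂_le_of_le k (R ∘ e.symm) <| iInf₂_le_of_le (hR.comp_equiv e.symm)
    (fun i => hRU _) le_rfl).trans (T.partitionH_comp_le P μ R e.symm.injective)

end BundleRDS

/-! ### The information function and the comparison of a partition with a cover. -/

namespace BundleRDS

section
variable {Ω : Type*} [MeasurableSpace Ω] {ϑ : Ω → Ω}
  {X : Type*} [TopologicalSpace X] [MeasurableSpace X] (T : BundleRDS ϑ X)

theorem skew_iterate_fst (n : ℕ) (z : T.E) : (T.skew^[n] z).1.1 = ϑ^[n] z.1.1 := by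
  have := T.skew_iterate n z.1.1 ⟨z.1.2, z.2⟩
  exact congrArg (fun y : T.E => y.1.1) this

variable [StandardBorelSpace X] [Nonempty X]
  {P : Measure Ω} {μ : Measure (Ω × X)} [IsProbabilityMeasure μ]

variable (μ) in
/-- The information function of a partition, with respect to the conditional measures `μ_ω`. -/
def information {ι : Type*} (Q : ι → Set T.E) (z : T.E) : ℝ≥0∞ :=
  ∑' a, (Q a).indicator (fun z => surprisal (T.fiberMeasure μ z.1.1 (Q a))) z

variable {T}

theorem measurable_surprisal_fiberMeasure {A : Set T.E} (hA : MeasurableSet A) :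
    Measurable fun ω => surprisal (T.fiberMeasure μ ω A) :=
  measurable_surprisal.comp (measurable_fiberMeasure μ hA)

theorem measurable_fiberMeasure_mul_surprisal {A : Set T.E} (hA : MeasurableSet A) :
    Measurable fun ω => T.fiberMeasure μ ω A * surprisal (T.fiberMeasure μ ω A) :=
  (measurable_fiberMeasure μ hA).mul (measurable_surprisal_fiberMeasure hA)

theorem measurable_indicator_surprisal {A : Set T.E} (hA : MeasurableSet A) :
    Measurable (A.indicator fun z => surprisal (T.fiberMeasure μ z.1.1 A)) :=
  ((measurable_surprisal_fiberMeasure hA).comp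
    (measurable_fst.comp measurable_subtype_coe)).indicator hA

theorem measurable_information {ι : Type*} [Countable ι] {Q : ι → Set T.E}
    (hQ : ∀ a, MeasurableSet (Q a)) : Measurable (T.information μ Q) :=
  Measurable.tsum fun a => measurable_indicator_surprisal (hQ a)

theorem surprisal_le_information {ι : Type*} {Q : ι → Set T.E} {z : T.E} {a : ι} (hz : z ∈ Q a) :
    surprisal (T.fiberMeasure μ z.1.1 (Q a)) ≤ T.information μ Q z := by
  refine le_trans ?_ (ENNReal.le_tsum a)
  rw [indicator_of_mem hz]

theorem lintegral_information {ι : Type*} [Countable ι] {Q : ι → Set T.E}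
    (hQ : ∀ a, MeasurableSet (Q a)) (hμP : μ.fst = P) :
    ∫⁻ z, T.information μ Q z ∂(μ.comap Subtype.val) = T.partitionH P μ Q := by
  rw [partitionH_eq_lintegral P μ hQ,
    lintegral_tsum fun a => (measurable_fiberMeasure_mul_surprisal (hQ a)).aemeasurable]
  simp only [information]
  rw [lintegral_tsum fun a => (measurable_indicator_surprisal (hQ a)).aemeasurable]
  refine tsum_congr fun a => ?_
  rw [← hμP, lintegral_fiberMeasure_mul μ (hQ a) (measurable_surprisal_fiberMeasure (hQ a)),
    lintegral_indicator (hQ a)]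

/-- If the partition `Q` is determined by the cover `U` up to a set `D`, then the entropy of the
join of `Q` exceeds that of a partition finer than the join of `U` by a bounded amount per step. -/
theorem partitionH_join_le (hϑ : Measurable ϑ) (hμ : T.IsInvariant P μ) {Q : ℕ → Set T.E}
    (hQ : IsMeasurablePartition Q) {κ : Type*} {U : κ → Set T.E} {c : κ → ℕ} {D : Set T.E}
    (hD : MeasurableSet D) (hUD : ∀ b a, a ≠ c b → U b ∩ Q a ⊆ D) {t : ℝ≥0∞} (ht : t ≤ 1) (n : ℕ)
    {ι : Type*} [Countable ι] {R : ι → Set T.E} (hR : IsMeasurablePartition R)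
    (hRU : IsFiner R (T.join U n)) :
    T.partitionH P μ (T.join Q n) ≤ T.partitionH P μ R + n * (surprisal (1 - t) +
      ∫⁻ z in D, (surprisal t + T.information μ Q z) ∂(μ.comap Subtype.val)) := by
  have hsk : Measurable T.skew := hμ.invariant.measurable
  have hQn := isMeasurablePartition_join T hsk hQ n
  choose r hr using hRU
  set ν : Measure T.E := μ.comap Subtype.val with hν
  have hν1 : ν univ = 1 := by
    rw [hν, comap_subtype_coe_apply T.measurableSet_E, image_univ, Subtype.range_coe, hμ.measure_E]
  let m := T.fiberMeasure μ
  have hm1 : ∀ ω A, m ω A ≤ 1 := fun ω A => T.fiberMeasure_le_one μ A ω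
  -- The one-letter code given the cover element b: weight 1 - t on the predicted cell c b, the rest
  -- spread like the conditional distribution of Q.
  let w : Ω → κ → ℕ → ℝ≥0∞ := fun ω b a => (if a = c b then 1 - t else 0) + t * m ω (Q a)
  have hw : ∀ ω b, ∑' a, w ω b a ≤ 1 := fun ω b => by
    simp only [w]
    rw [ENNReal.tsum_add, tsum_ite_eq, ENNReal.tsum_mul_left, hQ.tsum_measure]
    calc 1 - t + t * m ω univ ≤ 1 - t + t * 1 := by gcongr; exact hm1 _ _
      _ = 1 := by rw [mul_one, tsub_add_cancel_of_le ht]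
  have hw1 : ∀ ω b a, w ω b a ≤ 1 := fun ω b a => (ENNReal.le_tsum a).trans (hw ω b)
  have hwm : ∀ b a, Measurable fun ω => w ω b a := fun b a =>
    measurable_const.add ((measurable_fiberMeasure μ (hQ.1.1 a)).const_mul t)
  let W : Ω → ι → (Fin n → ℕ) → ℝ≥0∞ := fun ω j s => ∏ i : Fin n, w (ϑ^[(i : ℕ)] ω) (r j i) (s i)
  have hWm : ∀ j s, Measurable fun ω => surprisal (W ω j s) := fun j s =>
    measurable_surprisal.comp
      (Finset.measurable_fun_prod _ fun i _ => (hwm _ _).comp (hϑ.iterate i))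
  -- A bound for the code length of one letter: -log(1 - t) covers a correct prediction, and a wrong
  -- one occurs only in D, where the fallback weight t · m(Q a) is used.
  let ψ : T.E → ℝ≥0∞ := fun z =>
    surprisal (1 - t) + D.indicator (fun z => surprisal t + T.information μ Q z) z
  have hψ : Measurable ψ := measurable_const.add
    ((measurable_const.add (measurable_information hQ.1.1)).indicator hD)
  have hψw : ∀ z a b, z ∈ Q a → z ∈ U b → surprisal (w z.1.1 b a) ≤ ψ z := fun z a b ha hb => by
    by_cases h : a = c b
    · refine (surprisal_anti ?_).trans le_self_add
      simp only [w, h, if_true]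
      exact le_self_add
    · simp only [w, h, if_false, zero_add, ψ, indicator_of_mem (hUD b a h ⟨hb, ha⟩)]
      calc surprisal (t * m z.1.1 (Q a)) ≤ surprisal t + surprisal (m z.1.1 (Q a)) :=
            surprisal_mul_le _ _ ht (hm1 _ _)
        _ ≤ surprisal t + T.information μ Q z := by gcongr; exact surprisal_le_information ha
        _ ≤ _ := le_add_self
  let Ψ : T.E → ℝ≥0∞ := fun z => ∑ i : Fin n, ψ (T.skew^[(i : ℕ)] z)
  have hΨ : ∫⁻ z, Ψ z ∂ν = n * (surprisal (1 - t) +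
      ∫⁻ z in D, (surprisal t + T.information μ Q z) ∂ν) := by
    simp only [Ψ]
    have hψi : ∀ i : Fin n, Measurable fun z => ψ (T.skew^[(i : ℕ)] z) := fun i =>
      hψ.comp (hsk.iterate i)
    rw [lintegral_finsetSum _ fun i _ => hψi i]
    have h1 : ∀ i : Fin n, ∫⁻ z, ψ (T.skew^[(i : ℕ)] z) ∂ν = ∫⁻ z, ψ z ∂ν := fun i =>
      (hμ.invariant.iterate i).lintegral_comp hψ
    simp only [h1, Finset.sum_const, Finset.card_univ, Fintype.card_fin, nsmul_eq_mul]
    simp only [ψ]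
    rw [lintegral_add_left measurable_const, lintegral_const, hν1, mul_one, lintegral_indicator hD]
  have hWΨ : ∀ s j, ∀ z ∈ T.join Q n s ∩ R j, surprisal (W z.1.1 j s) ≤ Ψ z := fun s j z hz => by
    refine (surprisal_prod_le _ _ fun i => hw1 _ _ _).trans (Finset.sum_le_sum fun i _ => ?_)
    rw [← T.skew_iterate_fst]
    exact hψw _ _ _ (mem_iInter.1 hz.1 i) (mem_iInter.1 (hr j hz.2) i)
  -- On each fibre, the joint law of the Q-word and the cell of R is compared with the product code
  -- `W`.
  have hstat : ∀ᵐ ω ∂P,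
      ∑' s, m ω (T.join Q n s) * surprisal (m ω (T.join Q n s)) ≤
        ∑' j, m ω (R j) * surprisal (m ω (R j)) +
          ∑' s, ∑' j, m ω (T.join Q n s ∩ R j) * surprisal (W ω j s) := by
    have h1 := T.ae_fiberMeasure_univ μ hμ.measure_E
    rw [hμ.fst_eq] at h1
    filter_upwards [h1] with ω hω
    have e1 : ∀ s, ∑' j, m ω (T.join Q n s ∩ R j) = m ω (T.join Q n s) := fun s =>
      hR.tsum_measure_inter _ (hQn.1.1 s)
    have e2 : ∀ j, ∑' s, m ω (T.join Q n s ∩ R j) = m ω (R j) := fun j => by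
      simp_rw [inter_comm _ (R j)]
      exact hQn.tsum_measure_inter _ (hR.1.1 j)
    have h := tsum_mul_surprisal_le_add (fun s j => m ω (T.join Q n s ∩ R j))
      (by simp_rw [e1]; rw [hQn.tsum_measure]; exact hω) (W ω)
      (fun j => tsum_pi_prod_le_one n _ fun i => hw _ _)
    simpa only [e1, e2] using h
  have hmm : ∀ s j, Measurable fun ω => m ω (T.join Q n s ∩ R j) * surprisal (W ω j s) :=
    fun s j => (measurable_fiberMeasure μ ((hQn.1.1 s).inter (hR.1.1 j))).mul (hWm j s)
  rw [partitionH_eq_lintegral P μ hQn.1.1, partitionH_eq_lintegral P μ hR.1.1]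
  refine (lintegral_mono_ae hstat).trans ?_
  rw [lintegral_add_left (Measurable.tsum fun j => measurable_fiberMeasure_mul_surprisal (hR.1.1 j)),
    lintegral_tsum fun s => (Measurable.tsum fun j => hmm s j).aemeasurable]
  simp_rw [lintegral_tsum fun j => (hmm _ j).aemeasurable]
  gcongr
  rw [← hΨ]
  calc ∑' s, ∑' j, ∫⁻ ω, m ω (T.join Q n s ∩ R j) * surprisal (W ω j s) ∂P
      = ∑' s, ∑' j, ∫⁻ z in T.join Q n s ∩ R j, surprisal (W z.1.1 j s) ∂ν := by
        refine tsum_congr fun s => tsum_congr fun j => ?_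
        rw [← hμ.fst_eq]
        exact lintegral_fiberMeasure_mul μ ((hQn.1.1 s).inter (hR.1.1 j)) (hWm j s)
    -- Once the code length is replaced by Ψ, which does not depend on the cell, countable
    -- additivity of the measure with density Ψ collapses the double sum.
    _ ≤ ∑' s, ∑' j, (ν.withDensity Ψ) (T.join Q n s ∩ R j) := by
        gcongr with s j
        rw [withDensity_apply _ ((hQn.1.1 s).inter (hR.1.1 j))]
        exact setLIntegral_mono' ((hQn.1.1 s).inter (hR.1.1 j)) (hWΨ s j)
    _ = ∫⁻ z, Ψ z ∂ν := by
        simp_rw [hR.tsum_measure_inter _ (hQn.1.1 _)]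
        rw [hQn.tsum_measure, withDensity_apply _ .univ, Measure.restrict_univ]

end

/-! ### Open covers that almost determine a partition. -/

section
variable {Ω : Type*} [MeasurableSpace Ω] {ϑ : Ω → Ω} {X : Type*} [MetricSpace X]
  [MeasurableSpace X] [BorelSpace X] (T : BundleRDS ϑ X) (μ : Measure (Ω × X))
  [IsFiniteMeasure μ]

/-- A countable partition is determined, up to a set of small measure, by an open cover. -/
theorem exists_isOpenCover_inter_subset {Q : ℕ → Set T.E} (hQ : IsMeasurablePartition Q)
    {δ : ℝ≥0∞} (hδ : δ ≠ 0) :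
    ∃ (k : ℕ) (U : Fin k → Set T.E) (D : Set T.E), T.IsOpenCover U ∧ MeasurableSet D ∧
      μ.comap Subtype.val D < δ ∧ ∀ (b : Fin k) (a : ℕ), a ≠ b → U b ∩ Q a ⊆ D := by
  have hδ2 : δ / 2 ≠ 0 := by simpa using hδ
  have hQm : ∀ a, MeasurableSet (Subtype.val '' Q a) := fun a =>
    T.measurableSet_E.subtype_image (hQ.1.1 a)
  obtain ⟨n, hn⟩ := exists_measure_iUnion_diff_lt μ hQm hδ2
  obtain ⟨η, hη, hηδ⟩ := ENNReal.exists_pos_sum_of_countable' hδ2 ℕ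
  choose K hKQ hK hKc hKη using fun a =>
    (exists_closed_sections_open_sections μ (hQm a) (η a) (hη a).ne').1
  have hKa : ∀ {a a' : ℕ} {z : T.E}, z ∈ Q a → z.1 ∈ K a' → a' = a := fun {a a' z} hz hz' => by
    obtain ⟨y, hy, hyz⟩ := hKQ a' hz'
    rw [Subtype.ext hyz] at hy
    by_contra h
    exact disjoint_left.1 (hQ.2 h) hy hz
  have hex : ∀ z : T.E, ∃ a, z ∈ Q a := fun z => by
    have : z ∈ ⋃ a, Q a := hQ.1.2 ▸ mem_univ z
    exact mem_iUnion.1 this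
  -- A point of K_a lies in V_b only for b = a, and a point outside all K_a lies in every V_b. Using
  -- n + 1 indices rather than n keeps the family nonempty, which the covering property needs.
  let V : Fin (n + 1) → Set (Ω × X) := fun b =>
    (⋃ a ∈ (Finset.range (n + 1)).erase b, K a)ᶜ
  have hDm : MeasurableSet (⋃ a ∈ Finset.range (n + 1), K a) :=
    Finset.measurableSet_biUnion _ fun a _ => hK a
  refine ⟨n + 1, fun b => Subtype.val ⁻¹' V b,
    Subtype.val ⁻¹' (⋃ a ∈ Finset.range (n + 1), K a)ᶜ, ⟨V, ⟨fun b =>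
      (Finset.measurableSet_biUnion _ fun a _ => hK a).compl, ?_⟩, fun b ω => ?_, fun b => rfl⟩,
    measurable_subtype_coe hDm.compl, ?_, ?_⟩
  · refine eq_univ_of_forall fun z => ?_
    by_contra h
    have hz : ∀ b : Fin (n + 1), ∃ a : ℕ, (a ≠ b ∧ a < n + 1) ∧ z ∈ K a := fun b => by
      by_contra hb
      refine h (mem_iUnion.2 ⟨b, fun hzb => hb ?_⟩)
      simpa using hzb
    obtain ⟨a, ⟨-, ha⟩, hza⟩ := hz 0
    obtain ⟨a', ⟨ha', -⟩, hza'⟩ := hz ⟨a, ha⟩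
    obtain ⟨y, hy, rfl⟩ := hKQ a hza
    exact ha' (by simpa using hKa hy hza')
  · have : {x | (ω, x) ∈ V b} = (⋃ a ∈ (Finset.range (n + 1)).erase b, {x | (ω, x) ∈ K a})ᶜ := by
      ext; simp [V]
    rw [this]
    exact (isClosed_biUnion_finset fun a _ => hKc a ω).isOpen_compl
  · rw [comap_subtype_coe_apply T.measurableSet_E]
    calc μ (Subtype.val '' (Subtype.val ⁻¹' (⋃ a ∈ Finset.range (n + 1), K a)ᶜ : Set T.E))
        ≤ μ (((⋃ a, Subtype.val '' Q a) \ ⋃ a ∈ Finset.range n, Subtype.val '' Q a) ∪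
            ⋃ a, ((Subtype.val '' Q a) \ K a)) := by
          refine measure_mono ?_
          rintro _ ⟨z, hz, rfl⟩
          obtain ⟨a, ha⟩ := hex z
          have ha' : z.1 ∈ Subtype.val '' Q a := ⟨z, ha, rfl⟩
          by_cases h : z.1 ∈ ⋃ a ∈ Finset.range n, Subtype.val '' Q a
          · right
            simp only [mem_iUnion, exists_prop] at h
            obtain ⟨a', hn', hza'⟩ := h
            exact mem_iUnion.2 ⟨a', hza', fun hK' =>
              hz (mem_biUnion (Finset.range_mono n.le_succ hn') hK')⟩
          · exact Or.inl ⟨mem_iUnion.2 ⟨a, ha'⟩, h⟩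
      _ ≤ μ ((⋃ a, Subtype.val '' Q a) \ ⋃ a ∈ Finset.range n, Subtype.val '' Q a) +
            ∑' a, μ ((Subtype.val '' Q a) \ K a) :=
          (measure_union_le _ _).trans (by gcongr; exact measure_iUnion_le _)
      _ < δ / 2 + δ / 2 := ENNReal.add_lt_add hn
          ((ENNReal.tsum_le_tsum fun a => (hKη a).le).trans_lt hηδ)
      _ = δ := ENNReal.add_halves δ
  · rintro b a hab z ⟨hzb, hza⟩ hz
    simp only [mem_iUnion, exists_prop] at hz
    obtain ⟨a', ha', hza'⟩ := hz
    obtain rfl := hKa hza hza'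
    exact hzb (mem_biUnion (Finset.mem_erase.2 ⟨hab, ha'⟩) hza')

omit [BorelSpace X] in
theorem IsOpenCover.isMeasurableCover {T : BundleRDS ϑ X} {ι : Type*} {U : ι → Set T.E}
    (hU : T.IsOpenCover U) : IsMeasurableCover U := by
  obtain ⟨V, hV, -, hUV⟩ := hU
  obtain rfl : U = fun i => Subtype.val ⁻¹' V i := funext hUV
  exact ⟨fun i => measurable_subtype_coe (hV.1 i), by rw [← preimage_iUnion, hV.2, preimage_univ]⟩

end

/-! ### Cover entropy below partition entropy and below topological entropy. -/

section
variable {Ω : Type*} [MeasurableSpace Ω] {ϑ : Ω → Ω}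
  {X : Type*} [TopologicalSpace X] [MeasurableSpace X] [StandardBorelSpace X] [Nonempty X]
  {T : BundleRDS ϑ X} {P : Measure Ω} {μ : Measure (Ω × X)} [IsProbabilityMeasure μ]

theorem partitionH_lt_top_of_eq_empty [IsFiniteMeasure P] {Q : ℕ → Set T.E} {k : ℕ}
    (hQ : ∀ a, k ≤ a → Q a = ∅) : T.partitionH P μ Q < ∞ := by
  refine (lintegral_mono (g := fun _ => (k : ℝ≥0∞)) fun ω => ?_).trans_lt ?_
  · rw [tsum_eq_sum (s := Finset.range k)]
    · refine (Finset.sum_le_card_nsmul _ _ 1 fun a _ => ?_).trans (by simp)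
      rw [ENNReal.ofReal_le_one]
      have h0 : 0 ≤ (μ.condKernel ω).real (Subtype.val '' T.fiberSet (Q a) ω) := measureReal_nonneg
      have := Real.negMulLog_le_one_sub_self h0
      linarith
    · intro a ha
      simp [hQ a (by simpa using ha), fiberSet]
  · rw [lintegral_const]
    exact ENNReal.mul_lt_top (ENNReal.natCast_lt_top k) (measure_lt_top _ _)

/-- A partition obtained by choosing an element of U at each point has joins finer than those of U.
It is finite, so it competes both in `coverH` and, padded with empty cells, in `hMeas`. -/
theorem hMinus_le_hMeas [IsFiniteMeasure P] (hμ : T.IsInvariant P μ) {k : ℕ}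
    {U : Fin k → Set T.E} (hU : IsMeasurableCover U) : T.hMinus P μ U ≤ T.hMeas P μ := by
  obtain ⟨l, hl, hlU, -⟩ := exists_measurable_choice hU (F := fun _ => univ) measurable_const
  let Q : ℕ → Set T.E := fun a => (fun z => (l z : ℕ)) ⁻¹' {a}
  have hQ : IsMeasurablePartition Q :=
    isMeasurablePartition_preimage ((Measurable.of_discrete (f := fun i : Fin k => (i : ℕ))).comp hl)
  have hQk : ∀ a, k ≤ a → Q a = ∅ := fun a ha => by
    refine eq_empty_of_forall_notMem fun z hz => ?_
    have : (l z : ℕ) = a := hz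
    omega
  refine le_trans ?_ (le_iSup_of_le Q (le_iSup_of_le hQ (le_iSup_of_le
    (partitionH_lt_top_of_eq_empty hQk) le_rfl)))
  refine limsup_le_limsup (Eventually.of_forall fun n => ENNReal.div_le_div_right ?_ _)
  have hR := isMeasurablePartition_join T hμ.invariant.measurable
    (isMeasurablePartition_preimage hl) n
  refine (coverH_le_partitionH P μ hR fun s => ⟨s, iInter_mono fun i => ?_⟩).trans
    ((congrArg _ ?_).trans_le (T.partitionH_comp_le P μ (T.join Q n)
      (e := fun (s : Fin n → Fin k) i => (s i : ℕ)) ?_))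
  · intro z (hz : l (T.skew^[i] z) = s i)
    exact hz ▸ hlU _
  · ext s z
    simp [join, Q, Fin.ext_iff]
  · intro s s' h
    funext i
    exact Fin.ext (congrFun h i)

/-- The entropy of a cover is at most the integral of the logarithm of the number of its elements
that are needed to cover the fibers. -/
theorem coverH_le_lintegral (hμ : T.IsInvariant P μ) {S : Type*} [Fintype S]
    {U : S → Set T.E} (hU : IsMeasurableCover U) {N : Ω → ℕ}
    (hN : ∀ ω, ∃ F : Finset S, F.card = N ω ∧ ∀ x, ∃ s ∈ F, x ∈ T.fiberSet (U s) ω) :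
    T.coverH P μ U ≤ ∫⁻ ω, ENNReal.ofReal (Real.log (N ω)) ∂P := by
  classical
  let _ : MeasurableSpace S := ⊤
  let m := T.fiberMeasure μ
  let B : Finset S → Set T.E := fun F => (⋃ s ∈ F, U s)ᶜ
  have hB : ∀ F, MeasurableSet (B F) := fun F =>
    (Finset.measurableSet_biUnion _ fun s _ => hU.1 s).compl
  -- Asking for a covering only up to a null set makes this depend measurably on ω, and it can only
  -- lower the minimal cardinality. No measurability of N is then needed.
  let g : Ω → Set (Finset S) := fun ω => {F | m ω (B F) = 0}
  have hg : Measurable g := measurable_set_iff.2 fun F => measurable_mem.2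
    (measurable_fiberMeasure μ (hB F) (measurableSet_singleton 0))
  have hc : ∀ G : Set (Finset S), ∃ F, G.Nonempty → F ∈ G ∧ ∀ F' ∈ G, F.card ≤ F'.card := fun G => by
    by_cases hG : G.Nonempty
    · obtain ⟨F, hF, hF'⟩ := exists_min_image G Finset.card (toFinite G) hG
      exact ⟨F, fun _ => ⟨hF, hF'⟩⟩
    · exact ⟨∅, fun h => absurd h hG⟩
  choose c hc using hc
  have hFN : ∀ ω, m ω (B (c (g ω))) = 0 ∧ (c (g ω)).card ≤ N ω := fun ω => by
    obtain ⟨F, hF, hFx⟩ := hN ω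
    have hFg : F ∈ g ω := by
      have : m ω (B F) = 0 := by
        simp only [m]
        rw [fiberMeasure_apply μ (hB F)]
        convert measure_empty
        · rw [image_eq_empty]
          refine eq_empty_of_forall_notMem fun x hx => hx ?_
          obtain ⟨s, hs, hxs⟩ := hFx x
          exact mem_biUnion hs hxs
        · infer_instance
      exact this
    obtain ⟨h1, h2⟩ := hc (g ω) ⟨F, hFg⟩
    exact ⟨h1, (h2 F hFg).trans hF.le⟩
  let F : T.E → Set S := fun z => (c (g z.1.1) : Set S)
  have hF : Measurable F := (Measurable.of_discrete (f := fun G : Set (Finset S) => (c G : Set S))).comp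
    (hg.comp (measurable_fst.comp measurable_subtype_coe))
  obtain ⟨l, hl, hlU, hlF⟩ := exists_measurable_choice hU hF
  have hlF' : ∀ z, (∃ s ∈ c (g z.1.1), z ∈ U s) → l z ∈ c (g z.1.1) := hlF
  have hR := isMeasurablePartition_preimage hl
  have hRU : IsFiner (fun s => l ⁻¹' {s}) U := fun s => ⟨s, by rintro z rfl; exact hlU z⟩
  refine (coverH_le_partitionH P μ hR hRU).trans ?_
  rw [partitionH_eq_lintegral P μ hR.1.1]
  have h1 := T.ae_fiberMeasure_univ μ hμ.measure_E
  rw [hμ.fst_eq] at h1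
  refine lintegral_mono_ae (h1.mono fun ω hω => ?_)
  obtain ⟨hF0, hcard⟩ := hFN ω
  set C := c (g ω)
  -- The choice prefers C, so it leaves C only at points that C does not cover, which form a null
  -- set.
  have hsupp : ∀ s ∉ C, m ω (l ⁻¹' {s}) = 0 := fun s hs => by
    have hsub : T.fiberSet (l ⁻¹' {s}) ω ⊆ T.fiberSet (B C) ω := by
      intro x hxs
      let z : T.E := ⟨(ω, x.1), x.2⟩
      have hz : l z = s := hxs
      have hzB : z ∉ ⋃ s ∈ C, U s := fun h => by
        simp only [mem_iUnion, exists_prop] at h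
        have hC : l z ∈ C := hlF' z h
        exact hs (hz ▸ hC)
      exact hzB
    rw [← nonpos_iff_eq_zero, ← hF0]
    simp only [m]
    rw [fiberMeasure_apply μ (hR.1.1 s), fiberMeasure_apply μ (hB C)]
    exact measure_mono (image_mono hsub)
  have hsum : ∑' s, m ω (l ⁻¹' {s}) = 1 := by rw [hR.tsum_measure]; exact hω
  have hCne : C.Nonempty := by
    by_contra h
    rw [Finset.not_nonempty_iff_eq_empty] at h
    simp [hsupp, h] at hsum
  have hCpos : (0 : ℝ) < C.card := by exact_mod_cast hCne.card_pos
  -- Gibbs' inequality against the uniform vector on C yields the bound log |C|.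
  have hw : ∑' s, (if s ∈ C then (C.card : ℝ≥0∞)⁻¹ else 0) ≤ 1 := by
    rw [tsum_fintype, Finset.sum_ite_mem, Finset.univ_inter, Finset.sum_const, nsmul_eq_mul,
      ENNReal.mul_inv_cancel (by simpa using hCne.ne_empty) (ENNReal.natCast_ne_top _)]
  calc ∑' s, m ω (l ⁻¹' {s}) * surprisal (m ω (l ⁻¹' {s}))
      ≤ ∑' s, m ω (l ⁻¹' {s}) * surprisal (if s ∈ C then (C.card : ℝ≥0∞)⁻¹ else 0) :=
        tsum_mul_surprisal_le hsum hw
    _ = ∑' s, m ω (l ⁻¹' {s}) * surprisal (C.card : ℝ≥0∞)⁻¹ := by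
        refine tsum_congr fun s => ?_
        by_cases hs : s ∈ C
        · rw [if_pos hs]
        · rw [hsupp s hs, zero_mul, zero_mul]
    _ = ENNReal.ofReal (Real.log C.card) := by
        rw [ENNReal.tsum_mul_right, hsum, one_mul, surprisal,
          if_neg (ENNReal.inv_ne_zero.2 (ENNReal.natCast_ne_top _)), ENNReal.toReal_inv,
          ENNReal.toReal_natCast, Real.log_inv, neg_neg]
    _ ≤ ENNReal.ofReal (Real.log (N ω)) :=
        ENNReal.ofReal_le_ofReal (Real.log_le_log hCpos (by exact_mod_cast hcard))

theorem hMinus_le_hTop (hμ : T.IsInvariant P μ) {ι : Type*} [Fintype ι] {U : ι → Set T.E}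
    (hU : IsMeasurableCover U) : T.hMinus P μ U ≤ T.hTop P U := by
  classical
  refine limsup_le_limsup (Eventually.of_forall fun n => ENNReal.div_le_div_right ?_ _)
  have hUn := isMeasurableCover_join T hμ.invariant.measurable hU n
  have hmem : ∀ (s : Fin n → ι) (ω : Ω) (x : {x : X // (ω, x) ∈ T.E}),
      x ∈ T.fiberSet (T.join U n s) ω ↔
        x ∈ ⋂ i : Fin n, T.iter i ω ⁻¹' T.fiberSet (U (s i)) (ϑ^[(i : ℕ)] ω) := fun s ω x => by
    simp only [fiberSet, join, mem_ofPred_eq, mem_iInter, mem_preimage, T.skew_iterate]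
  refine coverH_le_lintegral hμ hUn fun ω => ?_
  -- The full family covers the fibre, so the infimum is attained and is not the default value 0 of
  -- `sInf ∅`.
  have hne : {m : ℕ | ∃ F : Finset (Fin n → ι), F.card = m ∧
      ⋃ s ∈ F, ⋂ i : Fin n, T.iter i ω ⁻¹' T.fiberSet (U (s i)) (ϑ^[(i : ℕ)] ω) = univ}.Nonempty := by
    refine ⟨_, Finset.univ, rfl, eq_univ_of_forall fun x => ?_⟩
    have : (⟨(ω, x.1), x.2⟩ : T.E) ∈ ⋃ s, T.join U n s := hUn.2 ▸ mem_univ _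
    obtain ⟨s, hs⟩ := mem_iUnion.1 this
    exact mem_biUnion (Finset.mem_univ s) ((hmem s ω x).1 hs)
  obtain ⟨F, hF, hFU⟩ := Nat.sInf_mem hne
  refine ⟨F, hF, fun x => ?_⟩
  have hx := hFU ▸ mem_univ x
  simp only [mem_iUnion, exists_prop] at hx
  obtain ⟨s, hs, hxs⟩ := hx
  exact ⟨s, hs, (hmem s ω x).2 hxs⟩

end

/-! ### Approximating the entropy of a partition by that of an open cover. -/

section
variable {Ω : Type*} [MeasurableSpace Ω] {ϑ : Ω → Ω} {X : Type*} [MetricSpace X]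
  [MeasurableSpace X] [BorelSpace X] [StandardBorelSpace X] [Nonempty X] {T : BundleRDS ϑ X}
  {P : Measure Ω} {μ : Measure (Ω × X)} [IsProbabilityMeasure μ]

/-- The order of choices matters: t first, so that -log(1 - t) < ε/2; then δ, depending on t, by
absolute continuity of the integral; then the cover, whose exceptional set has measure below δ. The
cover is thus independent of n. -/
theorem exists_isOpenCover_hPartition_le (hϑ : Measurable ϑ) (hμ : T.IsInvariant P μ)
    {Q : ℕ → Set T.E} (hQ : IsMeasurablePartition Q) (hQH : T.partitionH P μ Q < ∞)
    {ε : ℝ≥0∞} (hε : ε ≠ 0) :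
    ∃ (k : ℕ) (U : Fin k → Set T.E), T.IsOpenCover U ∧
      T.hPartition P μ Q ≤ T.hMinus P μ U + ε := by
  have hε2 : ε / 2 ≠ 0 := by simpa using hε
  obtain ⟨t, ht0, ht1, ht⟩ := exists_surprisal_one_sub_lt hε2
  have hν1 : μ.comap Subtype.val (univ : Set T.E) = 1 := by
    rw [comap_subtype_coe_apply T.measurableSet_E, image_univ, Subtype.range_coe, hμ.measure_E]
  -- Here the finite entropy of Q enters: it is the integral of the information function.
  have hint : ∫⁻ z, (surprisal t + T.information μ Q z) ∂(μ.comap Subtype.val) ≠ ∞ := by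
    rw [lintegral_add_left measurable_const, lintegral_const, hν1, mul_one,
      lintegral_information hQ.1.1 hμ.fst_eq]
    exact ENNReal.add_ne_top.2 ⟨surprisal_ne_top ht0, hQH.ne⟩
  obtain ⟨δ, hδ, hδε⟩ := exists_pos_setLIntegral_lt_of_measure_lt hint hε2
  obtain ⟨k, U, D, hU, hD, hDδ, hUD⟩ := T.exists_isOpenCover_inter_subset μ hQ hδ.ne'
  refine ⟨k, U, hU, ?_⟩
  have hn : ∀ n : ℕ, T.partitionH P μ (T.join Q n) ≤ T.coverH P μ (T.join U n) + n * ε := fun n => by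
    -- The error n * ε does not depend on R, so the bound passes to the infimum over R.
    simp only [coverH, ENNReal.iInf_add]
    refine le_iInf fun j => le_iInf fun R => le_iInf fun hR => le_iInf fun hRU => ?_
    refine (partitionH_join_le hϑ hμ hQ hD hUD ht1 n hR hRU).trans ?_
    gcongr
    exact (add_le_add ht.le (hδε D hDδ).le).trans_eq (ENNReal.add_halves ε)
  calc T.hPartition P μ Q
      ≤ limsup (fun n : ℕ => T.coverH P μ (T.join U n) / n + ε) atTop := by
        refine limsup_le_limsup ((eventually_gt_atTop 0).mono fun n hn0 => ?_)
        refine (ENNReal.div_le_div_right (hn n) _).trans_eq ?_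
        rw [ENNReal.add_div, mul_comm, ENNReal.mul_div_cancel_right (by simpa using hn0.ne')
          (ENNReal.natCast_ne_top n)]
    _ = T.hMinus P μ U + ε :=
        limsup_add_const _ _ _ (by isBoundedDefault) (by isBoundedDefault)

end
end BundleRDS

end

theorem lemma2p3 {Ω : Type*} [MeasurableSpace Ω] (P : Measure Ω) [IsProbabilityMeasure P]
    [P.IsComplete] {X : Type*} [MetricSpace X] [CompactSpace X] [Nonempty X]
    [MeasurableSpace X] [BorelSpace X]
    (ϑ : Ω ≃ᵐ Ω) (hϑ : MeasurePreserving ϑ P P)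
    (T : BundleRDS ϑ X) (hT : T.IsHomeomorphic P)
    (μ : Measure (Ω × X)) [IsProbabilityMeasure μ] (hμ : T.IsInvariant P μ) :
    T.hMeas P μ =
        ⨆ (k : ℕ) (U : Fin k → Set T.E) (_ : T.IsOpenCover U), T.hMinus P μ U ∧
      ∀ (k : ℕ) (U : Fin k → Set T.E), IsMeasurableCover U →
        T.hMinus P μ U ≤ T.hTop P U := by
  refine ⟨le_antisymm ?_ ?_, fun k U hU => BundleRDS.hMinus_le_hTop hμ hU⟩
  · refine iSup_le fun Q => iSup_le fun hQ => iSup_le fun hQH =>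
      ENNReal.le_of_forall_pos_le_add fun ε hε _ => ?_
    obtain ⟨k, U, hU, h⟩ := BundleRDS.exists_isOpenCover_hPartition_le ϑ.measurable hμ hQ hQH
      (ε := ε) (by exact_mod_cast hε.ne')
    refine h.trans ?_
    gcongr
    exact le_iSup_of_le k (le_iSup_of_le U (le_iSup_of_le hU le_rfl))
  · exact iSup_le fun k => iSup_le fun U => iSup_le fun hU =>
      BundleRDS.hMinus_le_hMeas hμ hU.isMeasurableCover
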